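/- Let $N\ge 0$. A Dellac configuration with $N$ columns is a tableau with $N$ columns (numbered from left to right) and $2N$ rows (numbered from bottom to top), containing $2N$ points, exactly one in each row and exactly two in each column, such that every box $(j:i)$ (column $j$, row $i$) containing a point satisfies $j\le i\le N+j$. Let $SDC_N$ be the set of symmetric Dellac configurations with $N$ columns, i.e. those that are invariant under the rotation of angle $\pi$ about the center of the tableau. Define polynomials by $D_0(x)=1$ and $$D_{n+1}(x)=(x+1)(x+2)D_n(x+2)-x(x+1)D_n(x)\qquad(n\ge 0),$$ by $P_1(x)=1$ and $$P_{n+1}(x)=\frac{(x+2)(x+1)}{2}P_n(x+2)-\frac{x(x-1)}{2}P_n(x)\qquad(n\ge 1),$$ and numbers $r_n=D_n(1)/2^n$ for $n\ge 0$. Then for every $n\ge 0$ the number of even symmetric Dellac configurations with $2n$ columns is $$|SDC_{2n}|=r_n=\frac{D_n(1)}{2^n}.$$ Moreover, for every $n\ge 1$, $D_n(x)=2^n(x+1)P_n(x+1)$ and $r_n=2P_n(2)$. The sequence $(r_n)_{n\ge 0}$ begins $1,2,10,98,1594$. -/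

import Mathlib

open Polynomial

noncomputable section

namespace SymmetricDellac

/-- A tableau with `N` columns and `2 * N` rows, given by the set of its boxes `(column, row)` that
contain a point. Columns are numbered from left to right and rows from bottom to top, both starting
at `0`. -/
abbrev Tableau (N : ℕ) : Type := Finset (Fin N × Fin (2 * N))

/-- Dellac configurations: one point per row, two points per column, and every point lies in a box
`(j, i)` with `j ≤ i ≤ N + j` (a condition that does not depend on whether both numberings start
at `0` or at `1`). -/
structure IsDellac {N : ℕ} (T : Tableau N) : Prop where
  row : ∀ i : Fin (2 * N), (T.filter fun p => p.2 = i).card = 1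
  col : ∀ j : Fin N, (T.filter fun p => p.1 = j).card = 2
  lower : ∀ p ∈ T, (p.1 : ℕ) ≤ (p.2 : ℕ)
  upper : ∀ p ∈ T, (p.2 : ℕ) ≤ N + (p.1 : ℕ)

/-- The rotation of angle `π` about the center of the tableau. -/
def rotate {N : ℕ} (T : Tableau N) : Tableau N :=
  T.image fun p => (p.1.rev, p.2.rev)

/-- The set of symmetric Dellac configurations with `N` columns. -/
def SDC (N : ℕ) : Set (Tableau N) :=
  {T | IsDellac T ∧ rotate T = T}

/-- The polynomials `D_n`: `D_0 = 1` and
`D_{n+1}(x) = (x+1)(x+2) D_n(x+2) - x(x+1) D_n(x)`. -/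
def D : ℕ → ℚ[X]
  | 0 => 1
  | n + 1 => (X + 1) * (X + 2) * (D n).comp (X + 2) - X * (X + 1) * D n

/-- The polynomials `P_n`, `n ≥ 1`: `P_1 = 1` and
`P_{n+1}(x) = (x+2)(x+1)/2 * P_n(x+2) - x(x-1)/2 * P_n(x)`. The value at `n = 0` is a placeholder. -/
def P : ℕ → ℚ[X]
  | 0 => 0
  | 1 => 1
  | n + 2 => C (1 / 2) * ((X + 2) * (X + 1) * (P (n + 1)).comp (X + 2) - X * (X - 1) * P (n + 1))

/-- The numbers `r_n = D_n(1) / 2^n`. -/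
def r (n : ℕ) : ℚ := (D n).eval 1 / 2 ^ n

end SymmetricDellac

end

/-!
A symmetric Dellac configuration with `N` columns is determined by the function `f` giving the
column of the point in each of the `N` lower rows (`ncard_SDC`). For `N = 2n`, such an `f` is only
required to satisfy `f i ≤ i` and to take values in each pair of opposite columns `j`, `N - 1 - j`
exactly twice (`mem_lowerFunctions_iff`). The configurations are therefore counted by the
coefficient of `x_0² ⋯ x_{n-1}²` in a product of `2n` linear forms, one for each lower row, in which
opposite columns carry the same variable (`card_lowerFunctions`).

In terms of the tail sums `d_i = x_i + ⋯ + x_{n-1}` and `w = d_0`, this product is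
`2 w² ∏_{1 ≤ i < n} (w² - d_i²)` (`prod_sum_Iic_foldCol`). The variable `x_0` occurs only in `w`, so
taking the coefficient of `x_0²` is taking half the second derivative in `w` at `w = d_1`, where the
factor `w² - d_1²` vanishes. To iterate, apply a polynomial `p(θ)` in the Euler operator
`θ = w d/dw` first: half the second derivative of `p(θ) ((w² - e²) F)` at `w = e` is the value there
of `q(θ) F`, where `2 q(x) = (x+2)(x+1) p(x+2) - x(x-1) p(x)` (`coeff_two_eulerEval`). This is the
recurrence of the `P n`, so that eliminating all the variables, starting from `p = 1`, leaves
`2 P_n(2)` (`coeff_eulerEval_tailProd`), which is `r n` by the relation between `D n` and `P n`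
(`D_succ_eq`).
-/

namespace SymmetricDellac

/-! ### Symmetric configurations as functions on the lower rows -/

/-- The inclusion of the lower half of the rows. -/
def lowRow {N : ℕ} (i : Fin N) : Fin (2 * N) := ⟨i, by omega⟩

/-- The column of each row in the symmetric tableau whose point in each lower row `i` lies in
column `f i`. -/
def symmExtend {N : ℕ} (f : Fin N → Fin N) (i : Fin (2 * N)) : Fin N :=
  if h : (i : ℕ) < N then f ⟨i, h⟩ else (f ⟨i.rev, by rw [Fin.val_rev]; omega⟩).rev

/-- The symmetric tableau determined by the columns of its lower rows. -/
def toTableau {N : ℕ} (f : Fin N → Fin N) : Tableau N :=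
  Finset.univ.filter fun p => p.1 = symmExtend f p.2

theorem mem_toTableau {N : ℕ} {f : Fin N → Fin N} {p : Fin N × Fin (2 * N)} :
    p ∈ toTableau f ↔ p.1 = symmExtend f p.2 := by
  simp [toTableau]

theorem symmExtend_lowRow {N : ℕ} (f : Fin N → Fin N) (i : Fin N) :
    symmExtend f (lowRow i) = f i := by
  simp [symmExtend, lowRow]

theorem symmExtend_rev {N : ℕ} (f : Fin N → Fin N) (i : Fin (2 * N)) :
    symmExtend f i.rev = (symmExtend f i).rev := by
  unfold symmExtend
  have h : (i.rev : ℕ) = 2 * N - (i + 1) := Fin.val_rev i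
  by_cases hi : (i : ℕ) < N
  · rw [dif_neg (by omega), dif_pos hi]
    simp only [Fin.rev_rev]
  · rw [dif_pos (by omega), dif_neg hi]
    simp only [Fin.rev_rev]

theorem eq_lowRow_or_eq_rev_lowRow {N : ℕ} (i : Fin (2 * N)) :
    (∃ k, i = lowRow k) ∨ ∃ k, i = (lowRow k).rev := by
  by_cases hi : (i : ℕ) < N
  · exact Or.inl ⟨⟨i, hi⟩, rfl⟩
  · refine Or.inr ⟨⟨i.rev, by rw [Fin.val_rev]; omega⟩, ?_⟩
    exact (Fin.rev_rev i).symm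

theorem mem_rotate {N : ℕ} {T : Tableau N} {p : Fin N × Fin (2 * N)} :
    p ∈ rotate T ↔ (p.1.rev, p.2.rev) ∈ T := by
  simp only [rotate, Finset.mem_image]
  constructor
  · rintro ⟨q, hq, rfl⟩
    simpa using hq
  · intro h
    exact ⟨_, h, by simp⟩

theorem rotate_toTableau {N : ℕ} (f : Fin N → Fin N) : rotate (toTableau f) = toTableau f := by
  ext p
  rw [mem_rotate, mem_toTableau, mem_toTableau, symmExtend_rev, Fin.rev_inj]

theorem toTableau_injective {N : ℕ} : Function.Injective (toTableau (N := N)) := by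
  intro f g h
  funext i
  have : (f i, lowRow i) ∈ toTableau f := by rw [mem_toTableau, symmExtend_lowRow]
  rw [h, mem_toTableau, symmExtend_lowRow] at this
  exact this

theorem card_row_toTableau {N : ℕ} (f : Fin N → Fin N) (i : Fin (2 * N)) :
    ((toTableau f).filter fun p => p.2 = i).card = 1 := by
  rw [Finset.card_eq_one]
  refine ⟨(symmExtend f i, i), ?_⟩
  ext ⟨a, b⟩
  simp only [Finset.mem_filter, mem_toTableau, Finset.mem_singleton, Prod.mk.injEq]
  constructor
  · rintro ⟨h, rfl⟩
    exact ⟨h, rfl⟩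
  · rintro ⟨h, rfl⟩
    exact ⟨h, rfl⟩

theorem card_col_toTableau {N : ℕ} (f : Fin N → Fin N) (j : Fin N) :
    ((toTableau f).filter fun p => p.1 = j).card =
      (Finset.univ.filter fun i => f i = j).card +
        (Finset.univ.filter fun i => f i = j.rev).card := by
  have hlow : Function.Injective fun i : Fin N => (j, lowRow i) := by
    intro a b h
    simpa [lowRow, Fin.ext_iff] using h
  have hup : Function.Injective fun i : Fin N => (j, (lowRow i).rev) := by
    intro a b h
    simpa [lowRow, Fin.ext_iff] using Fin.rev_injective (Prod.mk.inj h).2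
  rw [← Finset.card_image_of_injective _ hlow, ← Finset.card_image_of_injective _ hup,
    ← Finset.card_union_of_disjoint]
  · congr 1
    ext ⟨a, b⟩
    simp only [Finset.mem_filter, mem_toTableau, Finset.mem_union, Finset.mem_image,
      Finset.mem_univ, true_and, Prod.mk.injEq]
    constructor
    · rintro ⟨h, rfl⟩
      rcases eq_lowRow_or_eq_rev_lowRow b with ⟨k, rfl⟩ | ⟨k, rfl⟩
      · rw [symmExtend_lowRow] at h
        exact Or.inl ⟨k, h.symm, rfl, rfl⟩
      · rw [symmExtend_rev, symmExtend_lowRow] at h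
        exact Or.inr ⟨k, by rw [h, Fin.rev_rev], rfl, rfl⟩
    · rintro (⟨k, h, rfl, rfl⟩ | ⟨k, h, rfl, rfl⟩)
      · exact ⟨by rw [symmExtend_lowRow, h], rfl⟩
      · exact ⟨by rw [symmExtend_rev, symmExtend_lowRow, h, Fin.rev_rev], rfl⟩
  · rw [Finset.disjoint_left]
    intro p hp hq
    simp only [Finset.mem_image] at hp hq
    obtain ⟨a, -, rfl⟩ := hp
    obtain ⟨b, -, hb⟩ := hq
    have := congrArg (fun p => (p.2 : ℕ)) hb
    simp only [lowRow, Fin.val_rev] at this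
    omega

/-- The functions sending each lower row of a symmetric Dellac configuration to the column of its
point. A column receives its points from the lower rows directly, and from the upper rows through
the opposite column. -/
def lowerFunctions (N : ℕ) : Finset (Fin N → Fin N) :=
  Finset.univ.filter fun f => (∀ i, f i ≤ i) ∧ ∀ j,
    (Finset.univ.filter fun i => f i = j).card +
      (Finset.univ.filter fun i => f i = j.rev).card = 2

theorem isDellac_toTableau_iff {N : ℕ} {f : Fin N → Fin N} :
    IsDellac (toTableau f) ↔ f ∈ lowerFunctions N := by
  simp only [lowerFunctions, Finset.mem_filter, Finset.mem_univ, true_and]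
  constructor
  · intro h
    refine ⟨fun i => ?_, fun j => ?_⟩
    · exact h.lower (f i, lowRow i) (by rw [mem_toTableau, symmExtend_lowRow])
    · rw [← card_col_toTableau, h.col]
  · rintro ⟨hle, hcard⟩
    refine ⟨card_row_toTableau f, fun j => by rw [card_col_toTableau, hcard], ?_, ?_⟩
    all_goals
      rintro ⟨a, b⟩ hp
      rw [mem_toTableau] at hp
      dsimp only at hp ⊢
      subst hp
      rcases eq_lowRow_or_eq_rev_lowRow b with ⟨k, rfl⟩ | ⟨k, rfl⟩
      all_goals
        have hk : (f k : ℕ) ≤ k := hle k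
        simp only [symmExtend_rev, symmExtend_lowRow, Fin.val_rev]
        simp only [lowRow]
        omega

theorem exists_toTableau_eq {N : ℕ} {T : Tableau N} (hT : T ∈ SDC N) :
    ∃ f, toTableau f = T := by
  obtain ⟨hD, hrot⟩ := hT
  have hrow : ∀ i, ∃ j, ∀ a, (a, i) ∈ T ↔ a = j := by
    intro i
    obtain ⟨⟨c, i'⟩, hc⟩ := Finset.card_eq_one.1 (hD.row i)
    have h : ∀ p : Fin N × Fin (2 * N), p ∈ T ∧ p.2 = i ↔ p = (c, i') := by
      intro p
      simpa only [Finset.mem_filter, Finset.mem_singleton] using Finset.ext_iff.1 hc p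
    have hi : i' = i := ((h (c, i')).2 rfl).2
    subst hi
    refine ⟨c, fun a => ?_⟩
    simpa using h (a, i')
  choose g hg using hrow
  have hsymm : ∀ p : Fin N × Fin (2 * N), p ∈ T ↔ (p.1.rev, p.2.rev) ∈ T := by
    intro p
    rw [← mem_rotate, hrot]
  refine ⟨fun i => g (lowRow i), ?_⟩
  ext ⟨a, b⟩
  rw [mem_toTableau]
  dsimp only
  rcases eq_lowRow_or_eq_rev_lowRow b with ⟨k, rfl⟩ | ⟨k, rfl⟩
  · rw [symmExtend_lowRow, hg]
  · rw [symmExtend_rev, symmExtend_lowRow, hsymm, Fin.rev_rev, hg]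
    dsimp only
    rw [← Fin.rev_inj, Fin.rev_rev]

theorem ncard_SDC (N : ℕ) : (SDC N).ncard = (lowerFunctions N).card := by
  have : SDC N = toTableau '' (lowerFunctions N : Set (Fin N → Fin N)) := by
    ext T
    constructor
    · intro hT
      obtain ⟨f, rfl⟩ := exists_toTableau_eq hT
      exact ⟨f, isDellac_toTableau_iff.1 hT.1, rfl⟩
    · rintro ⟨f, hf, rfl⟩
      exact ⟨isDellac_toTableau_iff.2 hf, rotate_toTableau f⟩
  rw [this, Set.ncard_image_of_injective _ toTableau_injective, Set.ncard_coe_finset]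

/-! ### Functions of the Euler operator -/

/-- For `θ = X d/dX`, the linear functional sending `F` to the value of `p(θ) F` at `e`: the
coefficient of `X ^ m` is multiplied by `p(m)`. -/
noncomputable def eulerEval {R : Type*} [CommRing R] [Algebra ℚ R] (p : ℚ[X]) (e : R) :
    R[X] →ₗ[R] R :=
  lsum fun m => LinearMap.mulRight R (algebraMap ℚ R (p.eval (m : ℚ)) * e ^ m)

section Euler

variable {R S : Type*} [CommRing R] [Algebra ℚ R] [CommRing S] [Algebra ℚ S]

theorem eulerEval_monomial (p : ℚ[X]) (e : R) (m : ℕ) (a : R) :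
    eulerEval p e (monomial m a) = a * (algebraMap ℚ R (p.eval (m : ℚ)) * e ^ m) := by
  rw [eulerEval, lsum_apply, sum_monomial_index _ _ (by simp)]
  rfl

theorem eulerEval_one (e : R) (F : R[X]) : eulerEval 1 e F = F.eval e := by
  induction F using Polynomial.induction_on' with
  | add F G hF hG => rw [map_add, hF, hG, eval_add]
  | monomial m a => simp [eulerEval_monomial]

theorem map_eulerEval (φ : R →+* S) (p : ℚ[X]) (e : R) (F : R[X]) :
    φ (eulerEval p e F) = eulerEval p (φ e) (F.map φ) := by
  induction F using Polynomial.induction_on' with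
  | add F G hF hG => rw [map_add, map_add, hF, hG, Polynomial.map_add, map_add]
  | monomial m a =>
    have h : ∀ q : ℚ, φ (algebraMap ℚ R q) = algebraMap ℚ S q := fun q =>
      DFunLike.congr_fun (Subsingleton.elim (φ.comp (algebraMap ℚ R)) (algebraMap ℚ S)) q
    simp [eulerEval_monomial, h]

/-- The operator `p ↦ ((x+2)(x+1) p(x+2) - x(x-1) p(x)) / 2`, which carries each `P n`, `n ≥ 1`,
to the next. -/
noncomputable def stepP (p : ℚ[X]) : ℚ[X] :=
  C (1 / 2) * ((X + 2) * (X + 1) * p.comp (X + 2) - X * (X - 1) * p)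

/-- Since `θ (X² F) = X² (θ + 2) F` and the second divided derivative is `X⁻² θ (θ - 1) / 2`, taking
it of `p(θ) ((X² - e²) F)` at `X = e` applies `stepP p` at `θ` to `F`. -/
theorem coeff_two_eulerEval (p : ℚ[X]) (e : R) (F : R[X]) :
    (eulerEval p (X + C e) (((X ^ 2 - C (e ^ 2)) * F).map C)).coeff 2 =
      eulerEval (stepP p) e F := by
  induction F using Polynomial.induction_on' with
  | add F G hF hG =>
    rw [mul_add, Polynomial.map_add, map_add, coeff_add, hF, hG, map_add]
  | monomial m a =>
    have hcoeff : ∀ (k : ℕ) (b : R),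
        (eulerEval p (X + C e) ((monomial k b).map C)).coeff 2 =
          b * (algebraMap ℚ R (p.eval (k : ℚ) * (k * (k - 1) / 2)) * e ^ (k - 2)) := by
      intro k b
      rw [Polynomial.map_monomial, eulerEval_monomial, coeff_C_mul,
        show algebraMap ℚ R[X] (p.eval (k : ℚ)) = C (algebraMap ℚ R (p.eval (k : ℚ))) from rfl,
        coeff_C_mul, coeff_X_add_C_pow, map_mul, ← Nat.cast_choose_two, map_natCast]
      ring
    have hsplit : (X ^ 2 - C (e ^ 2)) * monomial m a =
        monomial (m + 2) a - monomial m (e ^ 2 * a) := by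
      rw [sub_mul, X_pow_mul, monomial_mul_X_pow, C_mul_monomial]
    have hstep : (stepP p).eval (m : ℚ) =
        p.eval ((m + 2 : ℕ) : ℚ) * (((m + 2 : ℕ) : ℚ) * ((m + 2 : ℕ) - 1) / 2) -
          p.eval (m : ℚ) * (m * (m - 1) / 2) := by
      simp only [stepP, eval_mul, eval_C, eval_sub, eval_add, eval_X, eval_one, eval_comp,
        eval_ofNat]
      push_cast
      ring
    rw [hsplit, Polynomial.map_sub, map_sub, coeff_sub, hcoeff, hcoeff, eulerEval_monomial, hstep,
      map_sub, Nat.add_sub_cancel]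
    -- For `m < 2` the truncated exponent `m - 2` is harmless: its coefficient `m (m - 1)` vanishes.
    rcases m with _ | _ | m
    · simp
    · simp
    · rw [show m + 1 + 1 - 2 = m by omega]
      ring

end Euler

/-! ### Eliminating the variables one at a time -/

/-- The tail sum `x_i + x_{i+1} + ⋯ + x_{n-1}`. -/
noncomputable def tailSum {n : ℕ} (i : ℕ) : MvPolynomial (Fin n) ℚ :=
  ∑ j ∈ Finset.univ.filter fun j : Fin n => i ≤ j, MvPolynomial.X j

theorem finSuccEquiv_tailSum_zero (n : ℕ) :
    MvPolynomial.finSuccEquiv ℚ n (tailSum 0) = X + C (tailSum 0) := by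
  simp [tailSum, Fin.sum_univ_succ, MvPolynomial.finSuccEquiv_X_zero,
    MvPolynomial.finSuccEquiv_X_succ]

theorem finSuccEquiv_tailSum_succ (n i : ℕ) :
    MvPolynomial.finSuccEquiv ℚ n (tailSum (i + 1)) = C (tailSum i) := by
  simp [tailSum, Finset.sum_filter, Fin.sum_univ_succ, apply_ite, MvPolynomial.finSuccEquiv_X_succ]

/-- `X² ∏_{1 ≤ i ≤ n} (X² - d_i²)`, where `d_i` is the tail sum of `n + 1` variables. -/
noncomputable def tailProd (n : ℕ) : (MvPolynomial (Fin (n + 1)) ℚ)[X] :=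
  X ^ 2 * ∏ i ∈ Finset.range n, (X ^ 2 - C (tailSum (i + 1) ^ 2))

/-- Removing the variable `x_0`, on which none of the `d_i` with `i ≥ 1` depends, lowers `n` by one
at the price of applying `stepP`. -/
theorem coeff_eulerEval_tailProd (n : ℕ) (p : ℚ[X]) :
    MvPolynomial.coeff (Finsupp.equivFunOnFinite.symm fun _ => 2)
      (eulerEval p (tailSum 0) (tailProd n)) = (stepP^[n] p).eval 2 := by
  induction n generalizing p with
  | zero =>
    rw [tailProd, Finset.prod_range_zero, mul_one, X_pow_eq_monomial, eulerEval_monomial, one_mul]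
    rw [show (tailSum 0 : MvPolynomial (Fin (0 + 1)) ℚ) = MvPolynomial.X 0 by simp [tailSum],
      MvPolynomial.algebraMap_eq, MvPolynomial.coeff_C_mul, MvPolynomial.coeff_X_pow, if_pos]
    · simp
    · ext i
      fin_cases i
      simp
  | succ n ih =>
    have hcons : (Finsupp.equivFunOnFinite.symm fun _ : Fin (n + 1 + 1) => 2) =
        Finsupp.cons 2 (Finsupp.equivFunOnFinite.symm fun _ : Fin (n + 1) => 2) := by
      ext i
      refine Fin.cases ?_ (fun i => ?_) i <;> simp
    have hmap : (tailProd (n + 1)).map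
        (MvPolynomial.finSuccEquiv ℚ (n + 1) : _ →+* (MvPolynomial (Fin (n + 1)) ℚ)[X]) =
          ((X ^ 2 - C (tailSum 0 ^ 2)) * tailProd n).map C := by
      rw [tailProd, tailProd, Finset.prod_range_succ']
      simp only [Polynomial.map_mul, Polynomial.map_prod, Polynomial.map_sub, Polynomial.map_pow,
        Polynomial.map_X, Polynomial.map_C, RingHom.coe_coe, map_pow, finSuccEquiv_tailSum_succ]
      ring
    rw [hcons, ← MvPolynomial.finSuccEquiv_coeff_coeff,
      ← RingHom.coe_coe (MvPolynomial.finSuccEquiv ℚ (n + 1)), map_eulerEval, hmap,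
      RingHom.coe_coe, finSuccEquiv_tailSum_zero, coeff_two_eulerEval, ih,
      Function.iterate_succ_apply]

theorem P_succ (n : ℕ) : P (n + 1) = stepP^[n] 1 := by
  induction n with
  | zero => rfl
  | succ n ih => rw [Function.iterate_succ_apply', ← ih]; rfl

/-! ### The count as a coefficient of a product -/

/-- The column of the left half of the tableau that is equal or opposite to the given one. -/
def foldCol {n : ℕ} (j : Fin (2 * n)) : Fin n :=
  if h : (j : ℕ) < n then ⟨j, h⟩ else ⟨j.rev, by rw [Fin.val_rev]; omega⟩

theorem foldCol_eq_foldCol_iff {n : ℕ} (i j : Fin (2 * n)) :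
    foldCol i = foldCol j ↔ i = j ∨ i = j.rev := by
  unfold foldCol
  have hi := Fin.val_rev i
  have hj := Fin.val_rev j
  split_ifs <;> simp only [Fin.ext_iff] <;> omega

theorem mem_lowerFunctions_iff {n : ℕ} {f : Fin (2 * n) → Fin (2 * n)} :
    f ∈ lowerFunctions (2 * n) ↔
      (∀ i, f i ≤ i) ∧ ∀ c, (Finset.univ.filter fun i => foldCol (f i) = c).card = 2 := by
  have hcard : ∀ j, (Finset.univ.filter fun i => f i = j).card +
      (Finset.univ.filter fun i => f i = j.rev).card =
        (Finset.univ.filter fun i => foldCol (f i) = foldCol j).card := by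
    intro j
    simp only [foldCol_eq_foldCol_iff]
    rw [Finset.filter_or, Finset.card_union_of_disjoint]
    -- A column differs from its opposite because the number of columns is even.
    rw [Finset.disjoint_filter]
    intro i _ h h'
    have := congrArg Fin.val (h.symm.trans h')
    rw [Fin.val_rev] at this
    omega
  simp only [lowerFunctions, Finset.mem_filter, Finset.mem_univ, true_and, hcard]
  refine and_congr_right fun _ => ⟨fun h c => ?_, fun h j => h _⟩
  have hc : foldCol (⟨c, by omega⟩ : Fin (2 * n)) = c := by simp [foldCol]
  rw [← hc]
  exact h _

theorem card_lowerFunctions (n : ℕ) :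
    ((lowerFunctions (2 * n)).card : ℚ) =
      MvPolynomial.coeff (Finsupp.equivFunOnFinite.symm fun _ => 2)
        (∏ i : Fin (2 * n), ∑ j ∈ Finset.Iic i, MvPolynomial.X (R := ℚ) (foldCol j)) := by
  have hmon : ∀ f : Fin (2 * n) → Fin (2 * n),
      ∏ i, MvPolynomial.X (R := ℚ) (foldCol (f i)) =
        MvPolynomial.monomial (∑ i, Finsupp.single (foldCol (f i)) 1) 1 := fun f =>
    (MvPolynomial.monomial_sum_one _ _).symm
  rw [Finset.prod_univ_sum, MvPolynomial.coeff_sum]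
  simp only [hmon, MvPolynomial.coeff_monomial]
  rw [Finset.sum_boole]
  congr 2
  ext f
  rw [mem_lowerFunctions_iff, Finset.mem_filter, Fintype.mem_piFinset]
  simp only [Finset.mem_Iic]
  refine and_congr_right fun _ => ?_
  rw [DFunLike.ext_iff]
  refine forall_congr' fun c => ?_
  rw [Finsupp.finsetSum_apply]
  simp only [Finsupp.single_apply, Finsupp.equivFunOnFinite_symm_apply_apply]
  rw [Finset.card_filter]

@[to_additive]
theorem prod_univ_lower_upper {M : Type*} [CommMonoid M] {n : ℕ} (g : Fin (2 * n) → M) :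
    ∏ i, g i = (∏ c : Fin n, g ⟨c, by omega⟩) * ∏ c : Fin n, g ⟨2 * n - 1 - c, by omega⟩ := by
  have key : ∀ (N : ℕ) (h : N = n + n) (g : Fin N → M),
      ∏ i, g i = (∏ c : Fin n, g ⟨c, by omega⟩) * ∏ c : Fin n, g ⟨N - 1 - c, by omega⟩ := by
    rintro N rfl g
    rw [Fin.prod_univ_add, ← Equiv.prod_comp Fin.revPerm fun c : Fin n => g (Fin.natAdd n c)]
    refine congrArg₂ (· * ·) rfl (Finset.prod_congr rfl fun c _ => ?_)
    refine congrArg g (Fin.ext ?_)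
    simp only [Fin.revPerm_apply, Fin.val_natAdd, Fin.val_rev]
    omega
  exact key _ (two_mul n) g

theorem sum_Iic_foldCol {n : ℕ} (i : Fin (2 * n)) :
    ∑ j ∈ Finset.Iic i, MvPolynomial.X (R := ℚ) (foldCol j) =
      if (i : ℕ) < n then tailSum 0 - tailSum (i + 1)
      else tailSum 0 + tailSum (2 * n - 1 - i) := by
  have hfilter : Finset.Iic i = Finset.univ.filter fun j => j ≤ i := by ext; simp
  have hlow : ∀ (c : Fin n) (h : (c : ℕ) < 2 * n), foldCol (⟨c, h⟩ : Fin (2 * n)) = c := by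
    intro c h
    simp [foldCol]
  have hup : ∀ (c : Fin n) (h : 2 * n - 1 - c < 2 * n),
      foldCol (⟨2 * n - 1 - c, h⟩ : Fin (2 * n)) = c := by
    intro c h
    unfold foldCol
    rw [dif_neg (by dsimp only; omega)]
    ext
    simp only [Fin.val_rev]
    omega
  rw [hfilter, Finset.sum_filter, sum_univ_lower_upper]
  simp only [hlow, hup, Fin.le_def, tailSum, Finset.sum_filter, zero_le, if_true]
  split_ifs with hi
  · rw [← Finset.sum_sub_distrib, ← Finset.sum_add_distrib]
    refine Finset.sum_congr rfl fun c _ => ?_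
    rw [if_neg (show ¬ 2 * n - 1 - (c : ℕ) ≤ i by omega)]
    by_cases hc : (c : ℕ) ≤ i
    · rw [if_pos hc, if_neg (by omega)]; ring
    · rw [if_neg hc, if_pos (by omega)]; ring
  · congr 1
    · exact Finset.sum_congr rfl fun c _ => if_pos (by omega)
    · refine Finset.sum_congr rfl fun c _ => ?_
      congr 1
      rw [eq_iff_iff]
      omega

theorem tailSum_self (n : ℕ) : (tailSum n : MvPolynomial (Fin n) ℚ) = 0 := by
  rw [tailSum, Finset.filter_false_of_mem, Finset.sum_empty]
  intro j _
  omega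

/-- With `w = d_0`, the lower row `i < n` contributes `w - d_{i+1}` and the row `2n - 1 - c`
contributes `w + d_c`; these pair up into the factors `w² - d_i²`. -/
theorem prod_sum_Iic_foldCol (n : ℕ) :
    ∏ i : Fin (2 * (n + 1)), ∑ j ∈ Finset.Iic i, MvPolynomial.X (R := ℚ) (foldCol j) =
      MvPolynomial.C 2 * eulerEval 1 (tailSum 0) (tailProd n) := by
  have hlow : ∀ c : Fin (n + 1), (c : ℕ) < n + 1 := fun c => c.2
  have hup : ∀ c : Fin (n + 1), ¬ 2 * (n + 1) - 1 - (c : ℕ) < n + 1 := by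
    intro c
    omega
  have hsub : ∀ c : Fin (n + 1), 2 * (n + 1) - 1 - (2 * (n + 1) - 1 - (c : ℕ)) = c := by
    intro c
    omega
  rw [prod_univ_lower_upper]
  simp only [sum_Iic_foldCol, hlow, hup, hsub, if_true, if_false]
  have h1 : ∏ c : Fin (n + 1), (tailSum 0 - tailSum (c + 1) : MvPolynomial (Fin (n + 1)) ℚ) =
      ∏ c ∈ Finset.range (n + 1), (tailSum 0 - tailSum (c + 1)) :=
    (Finset.prod_range fun c => (tailSum 0 - tailSum (c + 1) : MvPolynomial (Fin (n + 1)) ℚ)).symm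
  have h2 : ∏ c : Fin (n + 1), (tailSum 0 + tailSum c : MvPolynomial (Fin (n + 1)) ℚ) =
      ∏ c ∈ Finset.range (n + 1), (tailSum 0 + tailSum c) :=
    (Finset.prod_range fun c => (tailSum 0 + tailSum c : MvPolynomial (Fin (n + 1)) ℚ)).symm
  rw [h1, h2, Finset.prod_range_succ, Finset.prod_range_succ', tailSum_self, eulerEval_one, tailProd]
  simp only [eval_mul, eval_pow, eval_X, eval_prod, eval_sub, eval_C, sq_sub_sq,
    Finset.prod_mul_distrib, map_ofNat]
  ring

/-! ### The polynomials -/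

theorem D_succ_eq (n : ℕ) :
    D (n + 1) = C (2 ^ (n + 1)) * (X + 1) * (P (n + 1)).comp (X + 1) := by
  induction n with
  | zero =>
    simp only [D, P, one_comp, zero_add, pow_one, map_ofNat]
    ring
  | succ n ih =>
    have hP : (P (n + 1)).comp (X + 1 + 2) = (P (n + 1)).comp (X + 2 + 1) := by
      congr 1
      ring
    have hC : (C (2 ^ (n + 1 + 1)) * C (1 / 2) : ℚ[X]) = C (2 ^ (n + 1)) := by
      rw [← C_mul]
      congr 1
      ring
    rw [D, ih, P]
    simp only [mul_comp, add_comp, sub_comp, X_comp, C_comp, one_comp, ofNat_comp, comp_assoc,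
      Nat.cast_ofNat, hP]
    rw [← hC]
    have h2 : (C (1 / 2) * 2 : ℚ[X]) = 1 := by
      rw [← C_ofNat, ← C_mul]
      norm_num
    ring

theorem r_succ (n : ℕ) : r (n + 1) = 2 * (P (n + 1)).eval 2 := by
  rw [r, D_succ_eq]
  simp only [eval_mul, eval_C, eval_add, eval_X, eval_one, eval_comp]
  rw [show (1 : ℚ) + 1 = 2 by norm_num]
  field_simp

theorem ncard_SDC_two_mul (n : ℕ) : ((SDC (2 * n)).ncard : ℚ) = r n := by
  rw [ncard_SDC, card_lowerFunctions]
  rcases n with _ | n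
  · have h : (Finsupp.equivFunOnFinite.symm fun _ : Fin 0 => 2) = 0 := Subsingleton.elim _ _
    simp [r, D, h]
  · rw [prod_sum_Iic_foldCol, MvPolynomial.coeff_C_mul, coeff_eulerEval_tailProd, r_succ, P_succ]

end SymmetricDellac

theorem mainTheorem3 :
    (∀ n : ℕ, ((SymmetricDellac.SDC (2 * n)).ncard : ℚ) = SymmetricDellac.r n) ∧
    (∀ n : ℕ, 1 ≤ n →
      SymmetricDellac.D n =
        Polynomial.C (2 ^ n) * (Polynomial.X + 1) *
          (SymmetricDellac.P n).comp (Polynomial.X + 1) ∧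
      SymmetricDellac.r n = 2 * (SymmetricDellac.P n).eval 2) ∧
    (SymmetricDellac.r 0 = 1 ∧ SymmetricDellac.r 1 = 2 ∧ SymmetricDellac.r 2 = 10 ∧
      SymmetricDellac.r 3 = 98 ∧ SymmetricDellac.r 4 = 1594) := by
  refine ⟨SymmetricDellac.ncard_SDC_two_mul, fun n hn => ?_, ?_⟩
  · obtain ⟨n, rfl⟩ := Nat.exists_eq_add_of_le' hn
    exact ⟨SymmetricDellac.D_succ_eq n, SymmetricDellac.r_succ n⟩
  · norm_num [SymmetricDellac.r, SymmetricDellac.D]
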